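/- Let $m,n\ge 1$ be integers with $m+n\ge 3$, let $\Theta\in\mathbb R^{n\times m}$, and let $\sigma=(\sigma_1,\dots,\sigma_m)\in\mathbb R_{>0}^m$, $\rho=(\rho_1,\dots,\rho_n)\in\mathbb R_{>0}^n$ be weights with $\sigma_1\ge\dots\ge\sigma_m$, $\rho_1\ge\dots\ge\rho_n$ and $\sum_{j}\sigma_j=\sum_{i}\rho_i=1$. Put $|x|_\sigma=\max_j|x_j|^{1/\sigma_j}$ for $x\in\mathbb R^m$ and $|y|_\rho=\max_i|y_i|^{1/\rho_i}$ for $y\in\mathbb R^n$. The uniform weighted Diophantine exponent $\hat\omega_{\sigma,\rho}(\Theta)\in[-\infty,+\infty]$ is the supremum of the real numbers $\gamma$ such that for every sufficiently large $t$ the system $$|x|_\sigma\le t,\qquad |\Theta x-y|_\rho\le t^{-\gamma}$$ has a solution $(x,y)\in\mathbb Z^m\times\mathbb Z^n$ with $(x,y)\ne(0,0)$; the exponent $\hat\omega_{\rho,\sigma}({}^t\Theta)$ of the transposed matrix is defined in the same way, with the roles of $(m,\sigma)$ and $(n,\rho)$ interchanged. Set $\hat\omega=\hat\omega_{\sigma,\rho}(\Theta)$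 and ${}^t\hat\omega=\hat\omega_{\rho,\sigma}({}^t\Theta)$. Then $${}^t\hat\omega\ \ge\ \frac{1-\sigma_m\hat\omega^{-1}}{1-\sigma_m}\quad\text{if }\hat\omega\ge\frac{\sigma_m}{\rho_n},\qquad\qquad {}^t\hat\omega\ \ge\ \frac{1-\rho_n}{1-\rho_n\hat\omega}\quad\text{if }\hat\omega\le\frac{\sigma_m}{\rho_n}.$$ Here $(+\infty)^{-1}=0$, and a quotient whose denominator is $0$ is read as $+\infty$ (such a quotient always has a positive numerator, and it occurs only for $m=1$). -/

import Mathlib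

open Filter

/-- The weighted norm `|x|_w = max_j |x_j| ^ (1 / w_j)` (a maximum over a finite index set,
used for `k ≥ 1` and positive weights `w_j`). -/
noncomputable def weightedNorm {k : ℕ} (w : Fin k → ℝ) (x : Fin k → ℝ) : ℝ :=
  ⨆ j, |x j| ^ (1 / w j)

/-- The system `|x|_σ ≤ t`, `|Θ x - y|_ρ ≤ t ^ (-γ)` admits a solution
`(x, y) ∈ ℤ^m × ℤ^n` different from `(0, 0)`. -/
def HasNonzeroSolution {m n : ℕ} (σ : Fin m → ℝ) (ρ : Fin n → ℝ)
    (Θ : Matrix (Fin n) (Fin m) ℝ) (t γ : ℝ) : Prop :=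
  ∃ (x : Fin m → ℤ) (y : Fin n → ℤ), (x, y) ≠ (0, 0) ∧
    weightedNorm σ (fun j => (x j : ℝ)) ≤ t ∧
    weightedNorm ρ (fun i => Θ.mulVec (fun j => (x j : ℝ)) i - (y i : ℝ)) ≤ t ^ (-γ)

/-- The uniform weighted Diophantine exponent: the supremum in `[-∞, +∞]` of the real `γ` such
that the system is solvable in nonzero integer points for every `t` large enough. -/
noncomputable def uniformWeightedExponent {m n : ℕ} (σ : Fin m → ℝ) (ρ : Fin n → ℝ)
    (Θ : Matrix (Fin n) (Fin m) ℝ) : EReal :=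
  sSup ((fun γ : ℝ => (γ : EReal)) '' {γ : ℝ | ∀ᶠ t : ℝ in atTop, HasNonzeroSolution σ ρ Θ t γ})

/-- The quotient `a / b` of extended reals with the convention `a / 0 = +∞`
(to be used for `a > 0` when `b = 0`). -/
noncomputable def extQuot (a b : EReal) : EReal :=
  if b = 0 then ⊤ else a / b

/-! For `γ` admissible for `Θ` and `δ ≥ 1`, the bound `ω' ≥ δ` follows once, for all large `s`, the
dual lattice has a nonzero point in a fixed multiple of the box with sides `s ^ (-δσ_j)`, `s ^ ρ_i`.
The product of these sides is `s ^ (-(δ-1))`, too small for Minkowski's theorem alone when `δ > 1`.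
Points of the lattice of `Θ` make up for this: the pairing of the two lattices is integral, so a
value `u ⬝ᵥ w` of modulus less than 1 is 0. Hence one coordinate constraint can be traded for
orthogonality to a point `u`, or two for orthogonality to independent points `u`, `v`, provided the
coordinates of `u`, or the 2×2 minors of `u` and `v`, are small relative to the box
(`exists_dual_point_of_single`, `exists_dual_point_of_pair`).

Such points are found among consecutive minimal points. Between two of them lies an empty box, and
uniform solvability bounds its size (`le_rpow_of_empty_box`). In logarithmic coordinates this
becomes plane geometry with the smallest weights `σm`, `ρn` (`exists_good_point_or_pair`), and it
works under two inequalities between `γ` and `δ`. Solved for `δ`, they give the two quotients of the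
theorem, the smaller one changing at `σm / ρn` (`thresholds_lt_of_ge`, `thresholds_lt_of_le`). -/

/-! ### Minkowski's theorem and dual points orthogonal to given lattice points -/

section Minkowski

variable {ι : Type*} [Fintype ι] [DecidableEq ι]

/-- Minkowski's theorem on linear forms. -/
theorem exists_int_ne_zero_forall_abs_mulVec_lt (A : Matrix ι ι ℝ) (hA : A.det ≠ 0)
    (c : ι → ℝ) (hc : ∀ i, 0 < c i) (h : |A.det| < ∏ i, c i) :
    ∃ z : ι → ℤ, z ≠ 0 ∧ ∀ i, |A.mulVec (fun j => (z j : ℝ)) i| < c i := by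
  classical
  let b := Pi.basisFun ℝ ι
  have hF := ZSpan.isAddFundamentalDomain b (MeasureTheory.volume : MeasureTheory.Measure (ι → ℝ))
  have hFvol : MeasureTheory.volume (ZSpan.fundamentalDomain b) = 1 := by
    rw [ZSpan.volume_fundamentalDomain]
    have : Matrix.of ⇑b = 1 := by
      ext i j
      simp [b, Matrix.one_apply, Pi.single_apply, eq_comm]
    simp [this]
  let box : Set (ι → ℝ) := Set.pi Set.univ fun i => Set.Ioo (-c i) (c i)
  let s : Set (ι → ℝ) := Matrix.toLin' A ⁻¹' box
  have hdet : LinearMap.det (Matrix.toLin' A) ≠ 0 := by rwa [LinearMap.det_toLin']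
  have hvol : MeasureTheory.volume s =
      ENNReal.ofReal |A.det|⁻¹ * ENNReal.ofReal (2 ^ Fintype.card ι * ∏ i, c i) := by
    rw [MeasureTheory.Measure.addHaar_preimage_linearMap _ hdet, LinearMap.det_toLin', abs_inv]
    congr 1
    rw [Real.volume_pi_Ioo, ← ENNReal.ofReal_prod_of_nonneg]
    · congr 1
      rw [← Finset.card_univ, ← Finset.prod_const, ← Finset.prod_mul_distrib]
      exact Finset.prod_congr rfl fun i _ => by ring
    · intro i _
      linarith [hc i]
  have hpos : 0 < |A.det| := abs_pos.mpr hA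
  have : Countable (Submodule.span ℤ (Set.range b)).toAddSubgroup :=
    inferInstanceAs (Countable (Submodule.span ℤ (Set.range b)))
  obtain ⟨x, hx0, hxs⟩ :=
    MeasureTheory.exists_ne_zero_mem_lattice_of_measure_mul_two_pow_lt_measure
      (μ := MeasureTheory.volume) (s := s) (F := ZSpan.fundamentalDomain b)
      (L := (Submodule.span ℤ (Set.range b)).toAddSubgroup) hF
      (by
        intro x hx i hi
        have := hx i hi
        simp only [map_neg, Pi.neg_apply, Set.mem_Ioo] at this ⊢
        constructor <;> linarith [this.1, this.2])
      ((convex_pi fun i _ => convex_Ioo _ _).linear_preimage _)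
      (by
        rw [hFvol, one_mul, hvol, ← ENNReal.ofReal_mul (by positivity)]
        have : (2 : ENNReal) ^ Module.finrank ℝ (ι → ℝ) = ENNReal.ofReal (2 ^ Fintype.card ι) := by
          rw [Module.finrank_pi, ENNReal.ofReal_pow (by norm_num)]
          simp
        rw [this]
        have h2 : (0 : ℝ) < 2 ^ Fintype.card ι := by positivity
        have h1 : 1 < |A.det|⁻¹ * ∏ i, c i := by
          rw [inv_mul_eq_div, one_lt_div hpos]
          exact h
        have h3 := (mul_lt_mul_iff_right₀ h2).mpr h1
        refine (ENNReal.ofReal_lt_ofReal_iff (by nlinarith)).mpr ?_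
        nlinarith)
  have hmem : (x : ι → ℝ) ∈ Submodule.span ℤ (Set.range b) := x.2
  rw [Module.Basis.mem_span_iff_repr_mem] at hmem
  choose z hz using hmem
  have hxz : (x : ι → ℝ) = fun j => (z j : ℝ) := by
    ext j
    have := hz j
    simp [b] at this
    exact this.symm
  refine ⟨z, ?_, fun i => ?_⟩
  · rintro rfl
    apply hx0
    ext j
    simp [hxz]
  · have := hxs i (Set.mem_univ i)
    rw [hxz] at this
    exact abs_lt.mpr this

theorem det_one_updateRow (k : ι) (u : ι → ℝ) :
    ((1 : Matrix ι ι ℝ).updateRow k u).det = u k := by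
  rw [← Matrix.cramer_transpose_apply, Matrix.transpose_one, Matrix.cramer_one]
  rfl

/-- Changing two rows is a rank-two perturbation `1 + U * V`, and `det (1 + U * V) = det (1 + V *
U)` reduces the determinant to size 2. -/
theorem det_one_updateRow_updateRow {k l : ι} (hkl : k ≠ l) (u v : ι → ℝ) :
    (((1 : Matrix ι ι ℝ).updateRow k u).updateRow l v).det = u k * v l - u l * v k := by
  let U : Matrix ι (Fin 2) ℝ := Matrix.of fun i => ![if i = k then 1 else 0, if i = l then 1 else 0]
  let V : Matrix (Fin 2) ι ℝ := Matrix.of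
    ![fun j => u j - if j = k then 1 else 0, fun j => v j - if j = l then 1 else 0]
  have : ((1 : Matrix ι ι ℝ).updateRow k u).updateRow l v = 1 + U * V := by
    ext i j
    simp only [Matrix.updateRow_apply, Matrix.add_apply, Matrix.mul_apply, Fin.sum_univ_two,
      Matrix.one_apply, U, V, Matrix.of_apply, Matrix.cons_val_zero, Matrix.cons_val_one]
    by_cases h1 : i = l
    · subst h1
      simp [hkl.symm, eq_comm]
    · by_cases h2 : i = k
      · subst h2
        simp [hkl, eq_comm]
      · simp [h1, h2]
  rw [this, Matrix.det_one_add_mul_comm, Matrix.det_fin_two]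
  have h1 : ∀ (a : Fin 2) (b : Fin 2), (V * U) a b =
      V a (![k, l] b) := by
    intro a b
    fin_cases b <;> simp [Matrix.mul_apply, U]
  simp only [Matrix.add_apply, h1]
  simp [V, hkl, hkl.symm]

theorem updateRow_mulVec_ne {A : Matrix ι ι ℝ} {k r : ι} (h : r ≠ k) (u x : ι → ℝ) :
    (A.updateRow k u).mulVec x r = A.mulVec x r := by
  simp [Matrix.mulVec, Matrix.updateRow_ne h]

theorem updateRow_mulVec_self (A : Matrix ι ι ℝ) (k : ι) (u x : ι → ℝ) :
    (A.updateRow k u).mulVec x k = u ⬝ᵥ x := by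
  simp [Matrix.mulVec]

theorem Int.cast_eq_zero_of_abs_lt_one {a : ℝ} (h : ∃ z : ℤ, (z : ℝ) = a) (ha : |a| < 1) :
    a = 0 := by
  obtain ⟨z, rfl⟩ := h
  have : |z| < 1 := by exact_mod_cast ha
  simp [Int.abs_lt_one_iff.mp this]

/-- A nonzero dual lattice point orthogonal to one lattice point `u`. -/
theorem exists_dual_point_of_single (hcard : 2 ≤ Fintype.card ι)
    (N : Matrix ι ι ℝ) (hN : |N.det| = 1) (u : ι → ℝ) (hu : u ≠ 0)
    (huN : ∀ z : ι → ℤ, ∃ a : ℤ, (a : ℝ) = u ⬝ᵥ N.mulVec (fun j => (z j : ℝ)))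
    (μ : ι → ℝ) (hμ : ∀ i, 0 < μ i) (K : ℝ) (hK : 0 ≤ K)
    (h : ∀ k, |u k| * μ k ≤ K * ∏ i, μ i) :
    ∃ z : ι → ℤ, z ≠ 0 ∧
      ∀ i, |N.mulVec (fun j => (z j : ℝ)) i| ≤ (Fintype.card ι * (K + 1)) * μ i := by
  have hne : Nonempty ι := Fintype.card_pos_iff.mp (by omega)
  -- The constraint on coordinate `k` is the one replaced by the form `u ⬝ᵥ ·`. Maximality of `k`
  -- later allows `w k` to be recovered from the orthogonality relation.
  obtain ⟨k, hk⟩ := Finite.exists_max fun k => |u k| * μ k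
  have huk : u k ≠ 0 := by
    intro h0
    apply hu
    ext r
    have := hk r
    rw [h0] at this
    simp only [abs_zero, zero_mul] at this
    have h2 : |u r| ≤ 0 := by
      by_contra! h3
      have := mul_pos h3 (hμ r)
      linarith
    simpa using h2
  have hprod : ∏ i, μ i = μ k * ∏ i ∈ Finset.univ.erase k, μ i :=
    (Finset.mul_prod_erase _ _ (Finset.mem_univ k)).symm
  have hP : 0 < ∏ i ∈ Finset.univ.erase k, μ i := Finset.prod_pos fun i _ => hμ i
  obtain ⟨z, hz0, hz⟩ := exists_int_ne_zero_forall_abs_mulVec_lt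
    (((1 : Matrix ι ι ℝ).updateRow k u) * N)
    (by
      rw [Matrix.det_mul, det_one_updateRow]
      refine mul_ne_zero huk fun h0 => ?_
      simp [h0] at hN)
    (fun i => if i = k then 1 else (K + 1) * μ i)
    (by
      intro i
      have := hμ i
      split_ifs <;> positivity)
    (by
      rw [Matrix.det_mul, abs_mul, hN, det_one_updateRow, mul_one,
        ← Finset.mul_prod_erase _ _ (Finset.mem_univ k), if_pos rfl, one_mul]
      have h1 : ∏ i ∈ Finset.univ.erase k, (if i = k then (1 : ℝ) else (K + 1) * μ i) =
          (K + 1) ^ (Fintype.card ι - 1) * ∏ i ∈ Finset.univ.erase k, μ i := by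
        rw [← Finset.card_univ, ← Finset.card_erase_of_mem (Finset.mem_univ k),
          ← Finset.prod_const, ← Finset.prod_mul_distrib]
        exact Finset.prod_congr rfl fun i hi => by rw [if_neg (Finset.ne_of_mem_erase hi)]
      rw [h1]
      have h2 : |u k| ≤ K * ∏ i ∈ Finset.univ.erase k, μ i := by
        have := h k
        rw [hprod] at this
        nlinarith [hμ k]
      -- At least one coordinate keeps its factor `K + 1`; using `K + 1` rather than `K` makes
      -- Minkowski's inequality strict.
      have h3 : K + 1 ≤ (K + 1) ^ (Fintype.card ι - 1) :=
        le_self_pow₀ (by linarith) (by omega)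
      nlinarith)
  refine ⟨z, hz0, ?_⟩
  set w := N.mulVec (fun j => (z j : ℝ)) with hw
  simp only [← Matrix.mulVec_mulVec, ← hw] at hz
  have hcardR : (1 : ℝ) ≤ Fintype.card ι := by exact_mod_cast (by omega : 1 ≤ Fintype.card ι)
  have hr : ∀ r, r ≠ k → |w r| ≤ (K + 1) * μ r := by
    intro r hrk
    have := hz r
    rw [updateRow_mulVec_ne hrk, Matrix.one_mulVec, if_neg hrk] at this
    exact this.le
  have horth : u ⬝ᵥ w = 0 := by
    apply Int.cast_eq_zero_of_abs_lt_one (huN z)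
    have := hz k
    rwa [updateRow_mulVec_self, if_pos rfl] at this
  intro i
  by_cases hik : i = k
  · subst hik
    rw [dotProduct, ← Finset.add_sum_erase _ _ (Finset.mem_univ i)] at horth
    have h1 : |u i| * |w i| ≤ ∑ r ∈ Finset.univ.erase i, |u i| * μ i * (K + 1) := by
      rw [← abs_mul, eq_neg_of_add_eq_zero_left horth, abs_neg]
      refine (Finset.abs_sum_le_sum_abs _ _).trans (Finset.sum_le_sum fun r hr' => ?_)
      rw [abs_mul]
      have h2 := hr r (Finset.ne_of_mem_erase hr')
      have h3 := hk r
      calc |u r| * |w r| ≤ |u r| * ((K + 1) * μ r) := by gcongr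
        _ = (|u r| * μ r) * (K + 1) := by ring
        _ ≤ _ := by gcongr
    rw [Finset.sum_const, Finset.card_erase_of_mem (Finset.mem_univ i), Finset.card_univ,
      nsmul_eq_mul, Nat.cast_sub (by omega)] at h1
    have hui : 0 < |u i| := abs_pos.mpr huk
    have h4 : |u i| * |w i| ≤ |u i| * (Fintype.card ι * (K + 1) * μ i) := by
      have : 0 ≤ |u i| * μ i * (K + 1) := by have := hμ i; positivity
      push_cast at h1
      nlinarith
    exact le_of_mul_le_mul_left h4 hui
  · refine (hr i hik).trans ?_
    have := hμ i
    have : 0 ≤ (K + 1) * μ i := by positivity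
    nlinarith

/-- A nonzero dual lattice point orthogonal to two independent lattice points `u` and `v`. -/
theorem exists_dual_point_of_pair (hcard : 3 ≤ Fintype.card ι)
    (N : Matrix ι ι ℝ) (hN : |N.det| = 1) (u v : ι → ℝ)
    (huv : ∃ k l, u k * v l - u l * v k ≠ 0)
    (huN : ∀ z : ι → ℤ, ∃ a : ℤ, (a : ℝ) = u ⬝ᵥ N.mulVec (fun j => (z j : ℝ)))
    (hvN : ∀ z : ι → ℤ, ∃ a : ℤ, (a : ℝ) = v ⬝ᵥ N.mulVec (fun j => (z j : ℝ)))
    (μ : ι → ℝ) (hμ : ∀ i, 0 < μ i) (K : ℝ) (hK : 0 ≤ K)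
    (h : ∀ k l, |u k * v l - u l * v k| * (μ k * μ l) ≤ K * ∏ i, μ i) :
    ∃ z : ι → ℤ, z ≠ 0 ∧
      ∀ i, |N.mulVec (fun j => (z j : ℝ)) i| ≤ (Fintype.card ι * (K + 1)) * μ i := by
  have hne : Nonempty ι := Fintype.card_pos_iff.mp (by omega)
  obtain ⟨⟨k, l⟩, hmax⟩ := Finite.exists_max fun p : ι × ι =>
    |u p.1 * v p.2 - u p.2 * v p.1| * (μ p.1 * μ p.2)
  replace hmax : ∀ r q, |u r * v q - u q * v r| * (μ r * μ q) ≤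
      |u k * v l - u l * v k| * (μ k * μ l) := fun r q => hmax (r, q)
  have hW : u k * v l - u l * v k ≠ 0 := by
    intro h0
    obtain ⟨r, q, hrq⟩ := huv
    have h1 := hmax r q
    have h2 : 0 < |u r * v q - u q * v r| * (μ r * μ q) :=
      mul_pos (abs_pos.mpr hrq) (mul_pos (hμ r) (hμ q))
    rw [h0, abs_zero, zero_mul] at h1
    linarith
  have hkl : k ≠ l := by
    rintro rfl
    exact hW (by ring)
  have hlk : l ∈ Finset.univ.erase k := by simp [hkl.symm]
  set S := (Finset.univ.erase k).erase l with hS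
  have hScard : S.card = Fintype.card ι - 2 := by
    rw [hS, Finset.card_erase_of_mem hlk, Finset.card_erase_of_mem (Finset.mem_univ k),
      Finset.card_univ]
    omega
  have hSmem : ∀ r ∈ S, r ≠ k ∧ r ≠ l := by
    intro r hr
    simp only [hS, Finset.mem_erase, Finset.mem_univ, and_true] at hr
    exact ⟨hr.2, hr.1⟩
  have hprod : ∏ i, μ i = μ k * (μ l * ∏ i ∈ S, μ i) := by
    rw [hS, Finset.mul_prod_erase _ _ hlk, Finset.mul_prod_erase _ _ (Finset.mem_univ k)]
  have hP : 0 < ∏ i ∈ S, μ i := Finset.prod_pos fun i _ => hμ i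
  obtain ⟨z, hz0, hz⟩ := exists_int_ne_zero_forall_abs_mulVec_lt
    ((((1 : Matrix ι ι ℝ).updateRow k u).updateRow l v) * N)
    (by
      rw [Matrix.det_mul, det_one_updateRow_updateRow hkl]
      refine mul_ne_zero hW fun h0 => ?_
      simp [h0] at hN)
    (fun i => if i = k ∨ i = l then 1 else (K + 1) * μ i)
    (by
      intro i
      have := hμ i
      split_ifs <;> positivity)
    (by
      rw [Matrix.det_mul, abs_mul, hN, det_one_updateRow_updateRow hkl, mul_one,
        ← Finset.mul_prod_erase _ _ (Finset.mem_univ k), ← Finset.mul_prod_erase _ _ hlk, ← hS,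
        if_pos (Or.inl rfl), if_pos (Or.inr rfl), one_mul, one_mul]
      have h1 : ∏ i ∈ S, (if i = k ∨ i = l then (1 : ℝ) else (K + 1) * μ i) =
          (K + 1) ^ (Fintype.card ι - 2) * ∏ i ∈ S, μ i := by
        rw [← hScard, ← Finset.prod_const, ← Finset.prod_mul_distrib]
        refine Finset.prod_congr rfl fun i hi => ?_
        rw [if_neg (by have := hSmem i hi; tauto)]
      rw [h1]
      have hkl' : 0 < μ k * μ l := mul_pos (hμ k) (hμ l)
      have h2 : |u k * v l - u l * v k| ≤ K * ∏ i ∈ S, μ i := by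
        refine le_of_mul_le_mul_right ?_ hkl'
        refine (h k l).trans (le_of_eq ?_)
        rw [hprod]
        ring
      -- Two constraints have been replaced, so dimension at least 3 is needed for a factor `K + 1`
      -- to remain.
      have h3 : K + 1 ≤ (K + 1) ^ (Fintype.card ι - 2) :=
        le_self_pow₀ (by linarith) (by omega)
      nlinarith)
  refine ⟨z, hz0, ?_⟩
  set w := N.mulVec (fun j => (z j : ℝ)) with hw
  simp only [← Matrix.mulVec_mulVec, ← hw] at hz
  have hcardR : (1 : ℝ) ≤ Fintype.card ι := by exact_mod_cast (by omega : 1 ≤ Fintype.card ι)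
  have hr : ∀ r, r ≠ k → r ≠ l → |w r| ≤ (K + 1) * μ r := by
    intro r hrk hrl
    have := hz r
    rw [updateRow_mulVec_ne hrl, updateRow_mulVec_ne hrk, Matrix.one_mulVec,
      if_neg (by tauto)] at this
    exact this.le
  have horthu : u ⬝ᵥ w = 0 := by
    apply Int.cast_eq_zero_of_abs_lt_one (huN z)
    have := hz k
    rwa [updateRow_mulVec_ne hkl, updateRow_mulVec_self, if_pos (Or.inl rfl)] at this
  have horthv : v ⬝ᵥ w = 0 := by
    apply Int.cast_eq_zero_of_abs_lt_one (hvN z)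
    have := hz l
    rwa [updateRow_mulVec_self, if_pos (Or.inr rfl)] at this
  -- Eliminating `w b` from the two orthogonality relations expresses `w a` through the remaining
  -- coordinates, with minors as coefficients; the maximal minor is the one multiplying `w a`. It is
  -- applied to `(k, l)` and to `(l, k)`.
  have key : ∀ a b, a ≠ b → (∀ r, r ≠ a → r ≠ b → |w r| ≤ (K + 1) * μ r) →
      u a * v b - u b * v a ≠ 0 →
      (∀ r q, |u r * v q - u q * v r| * (μ r * μ q) ≤ |u a * v b - u b * v a| * (μ a * μ b)) →
      |w a| ≤ (Fintype.card ι * (K + 1)) * μ a := by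
    intro a b hab hw' hW' hmax'
    have h0 : ∑ r, (u r * v b - u b * v r) * w r = 0 := by
      have : ∑ r, (u r * v b - u b * v r) * w r = v b * (u ⬝ᵥ w) - u b * (v ⬝ᵥ w) := by
        rw [dotProduct, dotProduct, Finset.mul_sum, Finset.mul_sum, ← Finset.sum_sub_distrib]
        exact Finset.sum_congr rfl fun r _ => by ring
      rw [this, horthu, horthv]
      ring
    rw [← Finset.add_sum_erase _ _ (Finset.mem_univ a)] at h0
    have h1 : |u a * v b - u b * v a| * |w a| ≤
        ∑ r ∈ Finset.univ.erase a, |u a * v b - u b * v a| * μ a * (K + 1) := by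
      rw [← abs_mul, eq_neg_of_add_eq_zero_left h0, abs_neg]
      refine (Finset.abs_sum_le_sum_abs _ _).trans (Finset.sum_le_sum fun r hr' => ?_)
      rw [abs_mul]
      have hμa := hμ a
      by_cases hrb : r = b
      · subst hrb
        rw [sub_eq_zero.mpr rfl, abs_zero, zero_mul]
        positivity
      · have h2 := hw' r (Finset.ne_of_mem_erase hr') hrb
        have h3 : |u r * v b - u b * v r| * μ r ≤ |u a * v b - u b * v a| * μ a := by
          refine le_of_mul_le_mul_right ?_ (hμ b)
          have := hmax' r b
          linarith
        calc _ ≤ |u r * v b - u b * v r| * ((K + 1) * μ r) := by gcongr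
          _ = (|u r * v b - u b * v r| * μ r) * (K + 1) := by ring
          _ ≤ _ := by gcongr
    rw [Finset.sum_const, Finset.card_erase_of_mem (Finset.mem_univ a), Finset.card_univ,
      nsmul_eq_mul, Nat.cast_sub (by omega)] at h1
    have hui : 0 < |u a * v b - u b * v a| := abs_pos.mpr hW'
    have h4 : |u a * v b - u b * v a| * |w a| ≤
        |u a * v b - u b * v a| * (Fintype.card ι * (K + 1) * μ a) := by
      have : 0 ≤ |u a * v b - u b * v a| * μ a * (K + 1) := by have := hμ a; positivity
      push_cast at h1
      nlinarith
    exact le_of_mul_le_mul_left h4 hui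
  intro i
  by_cases hik : i = k
  · subst hik
    exact key i l hkl hr hW hmax
  by_cases hil : i = l
  · subst hil
    have hsw : u i * v k - u k * v i = -(u k * v i - u i * v k) := by ring
    refine key i k hik (fun r h1 h2 => hr r h2 h1) (by rw [hsw]; exact neg_ne_zero.mpr hW)
      fun r q => ?_
    rw [hsw, abs_neg, mul_comm (μ i)]
    exact hmax r q
  refine (hr i hik hil).trans ?_
  have := hμ i
  have : 0 ≤ (K + 1) * μ i := by positivity
  nlinarith

end Minkowski

/-! ### Minimal points in the plane -/

/-- If a box `{X < c, Y < b}` contains no point and every large `t` admits a point with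
`X ≤ t`, `Y ≤ t ^ (-γ)`, then `b ≤ c ^ (-γ)`. -/
theorem le_rpow_of_empty_box {P : Type*} {X Y : P → ℝ} {t₀ γ c b : ℝ} (hc : 0 < c) (ht : t₀ < c)
    (hex : ∀ t, t₀ ≤ t → ∃ p, X p ≤ t ∧ Y p ≤ t ^ (-γ)) (hbox : ∀ p, X p < c → b ≤ Y p) :
    b ≤ c ^ (-γ) := by
  have hlim : Tendsto (fun t : ℝ => t ^ (-γ)) (nhdsWithin c (Set.Iio c)) (nhds (c ^ (-γ))) :=
    ((Real.continuousAt_rpow_const c (-γ) (Or.inl hc.ne')).tendsto).mono_left nhdsWithin_le_nhds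
  refine ge_of_tendsto hlim ?_
  filter_upwards [Ioo_mem_nhdsLT ht] with t h
  obtain ⟨p, hpX, hpY⟩ := hex t h.1.le
  exact (hbox p (hpX.trans_lt h.2)).trans hpY

set_option maxHeartbeats 1000000 in
/-- Selection of one good point, or of two consecutive minimal points, in a planar
configuration. -/
theorem exists_good_point_or_pair {P : Type*} {X Y : P → ℝ}
    (hfin : ∀ a b, {p | X p ≤ a ∧ Y p ≤ b}.Finite) (hY : ∀ p, 0 ≤ Y p)
    (hX : ∀ p, Y p < 1 → 0 < X p) {t₀ γ δ σ ρ s : ℝ} (hσ : 0 < σ) (hρ : 0 < ρ) (hγ : 0 < γ)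
    (hδ : 1 ≤ δ) (hs : 1 < s) (hst : t₀ ≤ s ^ (1 / γ))
    (hex : ∀ t, t₀ ≤ t → ∃ p, X p ≤ t ∧ Y p ≤ t ^ (-γ))
    (hA : 1 ≤ γ * (δ - (δ - 1) / σ)) (hB : 1 + (δ - 1) / ρ ≤ γ * δ) :
    (∃ u, X u ≤ s ^ (δ - (δ - 1) / σ) ∧ Y u ≤ s ^ (-(1 + (δ - 1) / ρ))) ∨
    ∃ u v ξ₁ ξ₂ η₁ η₂, X u < X v ∧ Y v < Y u ∧ X u ≤ s ^ ξ₁ ∧ X v ≤ s ^ ξ₂ ∧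
      Y u ≤ s ^ (-η₁) ∧ Y v ≤ s ^ (-η₂) ∧ ξ₁ ≤ ξ₂ ∧ ξ₂ ≤ δ ∧ 1 ≤ η₁ ∧ η₁ ≤ η₂ ∧
      δ - 1 ≤ σ * (δ - ξ₁) + σ * (δ - ξ₂) ∧ δ - 1 ≤ σ * (δ - ξ₂) + ρ * (η₁ - 1) ∧
      δ - 1 ≤ ρ * (η₁ - 1) + ρ * (η₂ - 1) := by
  have hs0 : 0 < s := by linarith
  obtain ⟨D, hD⟩ : ∃ D, D = δ - 1 := ⟨_, rfl⟩
  have hD0 : 0 ≤ D := by linarith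
  rw [← hD] at hA hB ⊢
  obtain ⟨ξA, hξA⟩ : ∃ ξA, ξA = δ - D / σ := ⟨_, rfl⟩
  obtain ⟨ηB, hηB⟩ : ∃ ηB, ηB = 1 + D / ρ := ⟨_, rfl⟩
  rw [← hξA] at hA ⊢
  rw [← hηB] at hB ⊢
  have hσA : σ * (δ - ξA) = D := by rw [hξA]; field_simp; ring
  have hρB : ρ * (ηB - 1) = D := by rw [hηB]; field_simp; ring
  have hηB1 : 1 ≤ ηB := by rw [hηB]; linarith [div_nonneg hD0 hρ.le]
  have hAδ : ξA ≤ δ := by rw [hξA]; linarith [div_nonneg hD0 hσ.le]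
  have hA1 : 1 / γ ≤ ξA := by rw [div_le_iff₀ hγ]; linarith
  have hA0 : 0 < ξA := lt_of_lt_of_le (by positivity) hA1
  -- On the line `η = γ * ξ` the right side is affine in `ξ`, so the endpoints suffice: `hA` settles
  -- `ξ = ξA` and `hB` settles `ξ = δ`.
  have line : ∀ ξ η, ξA ≤ ξ → ξ ≤ δ → γ * ξ ≤ η → D ≤ σ * (δ - ξ) + ρ * (η - 1) := by
    intro ξ η h1 h2 h3
    have h4 : ρ * (γ * ξ - 1) ≤ ρ * (η - 1) := by gcongr
    rcases le_total σ (ρ * γ) with h | h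
    · nlinarith [mul_nonneg (sub_nonneg.mpr h) (sub_nonneg.mpr h1), mul_nonneg hρ.le (sub_nonneg.mpr hA)]
    · nlinarith [mul_nonneg (sub_nonneg.mpr h) (sub_nonneg.mpr h2), mul_nonneg hρ.le (sub_nonneg.mpr hB)]
  have one_le : ∀ ξ η, ξA ≤ ξ → γ * ξ ≤ η → 1 ≤ η := by
    intro ξ η h1 h2
    nlinarith
  have mono : ∀ {a b : ℝ}, a ≤ b → s ^ a ≤ s ^ b := fun h => Real.rpow_le_rpow_of_exponent_le hs.le h
  have le_iff : ∀ {a b : ℝ}, s ^ a ≤ s ^ b ↔ a ≤ b := Real.rpow_le_rpow_left_iff hs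
  have lt_iff : ∀ {a b : ℝ}, s ^ a < s ^ b ↔ a < b := Real.rpow_lt_rpow_left_iff hs
  have hexs : ∀ ξ, ξA ≤ ξ → ∃ p, X p ≤ s ^ ξ ∧ Y p ≤ s ^ (-(γ * ξ)) := by
    intro ξ h
    obtain ⟨p, h1, h2⟩ := hex (s ^ ξ) (hst.trans (mono (hA1.trans h)))
    refine ⟨p, h1, h2.trans (le_of_eq ?_)⟩
    rw [← Real.rpow_mul hs0.le]
    ring_nf
  have small : ∀ ξ, ξA ≤ ξ → s ^ (-(γ * ξ)) < 1 := by
    intro ξ h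
    refine Real.rpow_lt_one_of_one_lt_of_neg hs ?_
    nlinarith
  have boxs : ∀ ξ η, ξA < ξ → (∀ p, X p < s ^ ξ → s ^ (-η) ≤ Y p) → γ * ξ ≤ η := by
    intro ξ η h1 h2
    have h3 := le_rpow_of_empty_box (Real.rpow_pos_of_pos hs0 ξ)
      (hst.trans_lt (lt_iff.mpr (hA1.trans_lt h1))) hex h2
    rw [← Real.rpow_mul hs0.le, le_iff] at h3
    linarith
  have hlog : ∀ {a : ℝ}, 0 < a → s ^ Real.logb s a = a := fun h =>
    Real.rpow_logb hs0 hs.ne' h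
  -- the point `u`, minimal up to height `s ^ ξ₀`
  obtain ⟨ξ₀, hξ₀⟩ : ∃ ξ₀, ξ₀ = δ - D / (2 * σ) := ⟨_, rfl⟩
  have hσ0 : 2 * (σ * (δ - ξ₀)) = D := by rw [hξ₀]; field_simp; ring
  have hA0' : ξA ≤ ξ₀ := by
    by_contra! h
    nlinarith [mul_lt_mul_of_pos_left h hσ]
  have h0δ : ξ₀ ≤ δ := by rw [hξ₀]; linarith [div_nonneg hD0 (by positivity : (0:ℝ) ≤ 2 * σ)]
  obtain ⟨p₀, hp₀⟩ := hexs ξ₀ hA0'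
  -- Ties in `Y` are broken by `X`, so every point with smaller `X` has strictly larger `Y`.
  obtain ⟨u, ⟨huX, huY⟩, humin⟩ := Set.exists_min_image
    {p | X p ≤ s ^ ξ₀ ∧ Y p ≤ s ^ (-(γ * ξ₀))} (fun p => toLex (Y p, X p)) (hfin _ _) ⟨p₀, hp₀⟩
  have hu : ∀ p, X p ≤ s ^ ξ₀ → Y u < Y p ∨ Y u = Y p ∧ X u ≤ X p := by
    intro p hp
    by_cases h : Y p ≤ s ^ (-(γ * ξ₀))
    · have := humin p ⟨hp, h⟩
      rwa [Prod.Lex.toLex_le_toLex] at this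
    · exact Or.inl (huY.trans_lt (not_le.mp h))
  have huX0 : 0 < X u := hX u (huY.trans_lt (small _ hA0'))
  obtain ⟨ξu, hξu⟩ : ∃ ξ, X u = s ^ ξ := ⟨_, (hlog huX0).symm⟩
  have hξu0 : ξu ≤ ξ₀ := by rwa [hξu, le_iff] at huX
  have hαu : D ≤ 2 * (σ * (δ - ξu)) := by nlinarith
  -- the following minimal point
  have next : s ^ (-ηB) < Y u → ∃ w ξw ηu, Y u = s ^ (-ηu) ∧ X w = s ^ ξw ∧ Y w < Y u ∧
      ξ₀ < ξw ∧ ξw ≤ δ ∧ γ * ξw ≤ ηu := by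
    intro hBu
    obtain ⟨p, hpX, hpY⟩ := hexs δ hAδ
    have hpu : Y p < Y u := (hpY.trans (mono (by linarith))).trans_lt hBu
    obtain ⟨w, ⟨⟨hwX, hwY'⟩, hwY⟩, hwmin⟩ := Set.exists_min_image
      ({p | X p ≤ s ^ δ ∧ Y p ≤ Y u} ∩ {p | Y p < Y u}) X ((hfin _ _).inter_of_left _)
      ⟨p, ⟨hpX, hpu.le⟩, hpu⟩
    rw [Set.mem_ofPred_eq] at hwY
    have hwX0 : 0 < X w := hX w (hwY.trans (huY.trans_lt (small _ hA0')))
    obtain ⟨ξw, hξw⟩ : ∃ ξ, X w = s ^ ξ := ⟨_, (hlog hwX0).symm⟩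
    obtain ⟨ηu, hηu⟩ : ∃ η, Y u = s ^ (-η) :=
      ⟨-Real.logb s (Y u), by rw [neg_neg, hlog (lt_trans (Real.rpow_pos_of_pos hs0 _) hBu)]⟩
    have h0w : ξ₀ < ξw := by
      by_contra! h
      rcases hu w (by rw [hξw]; exact mono h) with h' | h' <;> linarith
    refine ⟨w, ξw, ηu, hηu, hξw, hwY, h0w, ?_, ?_⟩
    · rwa [hξw, le_iff] at hwX
    · refine boxs _ _ (hA0'.trans_lt h0w) fun q hq => ?_
      rw [← hηu]
      by_contra! hqu
      have := hwmin q ⟨⟨?_, hqu.le⟩, hqu⟩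
      · linarith
      · rw [← hξw] at hq
        exact hq.le.trans hwX
  -- the pair formed by `u` and its successor
  have pair_next : ∀ w ξw ηu, Y u = s ^ (-ηu) → X w = s ^ ξw → Y w < Y u →
      ξ₀ < ξw → ξw ≤ δ → γ * ξw ≤ ηu → D ≤ σ * (δ - ξu) + σ * (δ - ξw) →
      ∃ u v ξ₁ ξ₂ η₁ η₂, X u < X v ∧ Y v < Y u ∧ X u ≤ s ^ ξ₁ ∧ X v ≤ s ^ ξ₂ ∧
      Y u ≤ s ^ (-η₁) ∧ Y v ≤ s ^ (-η₂) ∧ ξ₁ ≤ ξ₂ ∧ ξ₂ ≤ δ ∧ 1 ≤ η₁ ∧ η₁ ≤ η₂ ∧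
      D ≤ σ * (δ - ξ₁) + σ * (δ - ξ₂) ∧ D ≤ σ * (δ - ξ₂) + ρ * (η₁ - 1) ∧
      D ≤ ρ * (η₁ - 1) + ρ * (η₂ - 1) := by
    intro w ξw ηu hYu hXw hYw h0w hwδ hline hsum
    have h1 := line ξw ηu (hA0'.trans h0w.le) hwδ hline
    -- `Y w` may vanish and then has no logarithm, so `ηu` serves for both points. The last
    -- inequality survives: `ξw > ξ₀` together with `h1` gives `ρ * (ηu - 1) ≥ D / 2`.
    refine ⟨u, w, ξu, ξw, ηu, ηu, ?_, hYw, hξu.le, hXw.le, hYu.le, hYw.le.trans hYu.le,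
      by linarith, hwδ, one_le ξw ηu (hA0'.trans h0w.le) hline, le_rfl, hsum, h1, ?_⟩
    · rw [hξu, hXw]
      exact lt_iff.mpr (by linarith)
    · nlinarith
  by_cases hAu : ξu ≤ ξA
  · by_cases hBu : Y u ≤ s ^ (-ηB)
    · exact Or.inl ⟨u, by rw [hξu]; exact mono hAu, hBu⟩
    · obtain ⟨w, ξw, ηu, h1, h2, h3, h4, h5, h6⟩ := next (not_le.mp hBu)
      refine Or.inr (pair_next w ξw ηu h1 h2 h3 h4 h5 h6 ?_)
      nlinarith [mul_nonneg hσ.le (sub_nonneg.mpr h5), mul_nonneg hσ.le (sub_nonneg.mpr hAu)]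
  · right
    rw [not_le] at hAu
    -- the preceding minimal point
    obtain ⟨p₁, hp₁X, hp₁Y⟩ := hexs ξA le_rfl
    have hp₁ : X p₁ < X u := hp₁X.trans_lt (by rw [hξu]; exact lt_iff.mpr hAu)
    obtain ⟨p, ⟨⟨hpX', hpY⟩, hpX⟩, hpmin⟩ := Set.exists_min_image
      ({p | X p ≤ X u ∧ Y p ≤ s ^ (-(γ * ξA))} ∩ {p | X p < X u}) Y ((hfin _ _).inter_of_left _)
      ⟨p₁, ⟨hp₁.le, hp₁Y⟩, hp₁⟩
    rw [Set.mem_ofPred_eq] at hpX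
    have hup : Y u < Y p := by
      rcases hu p (hpX.le.trans huX) with h | h
      · exact h
      · linarith [h.2]
    have hpX0 : 0 < X p := hX p (hpY.trans_lt (small _ le_rfl))
    obtain ⟨ξp, hξp⟩ : ∃ ξ, X p = s ^ ξ := ⟨_, (hlog hpX0).symm⟩
    obtain ⟨ηp, hηp⟩ : ∃ η, Y p = s ^ (-η) :=
      ⟨-Real.logb s (Y p), by rw [neg_neg, hlog ((hY u).trans_lt hup)]⟩
    have hline : γ * ξu ≤ ηp := by
      refine boxs _ _ hAu fun q hq => ?_
      rw [← hηp]
      rw [← hξu] at hq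
      by_cases h : Y q ≤ s ^ (-(γ * ξA))
      · exact hpmin q ⟨⟨hq.le, h⟩, hq⟩
      · exact hpY.trans (not_le.mp h).le
    have h1 := line ξu ηp hAu.le (hξu0.trans h0δ) hline
    have hηp1 := one_le ξu ηp hAu.le hline
    have hpu : ξp < ξu := by rwa [hξp, hξu, lt_iff] at hpX
    have prev : ∀ η, Y u ≤ s ^ (-η) → ηp ≤ η → D ≤ ρ * (ηp - 1) + ρ * (η - 1) →
        ∃ u v ξ₁ ξ₂ η₁ η₂, X u < X v ∧ Y v < Y u ∧ X u ≤ s ^ ξ₁ ∧ X v ≤ s ^ ξ₂ ∧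
        Y u ≤ s ^ (-η₁) ∧ Y v ≤ s ^ (-η₂) ∧ ξ₁ ≤ ξ₂ ∧ ξ₂ ≤ δ ∧ 1 ≤ η₁ ∧ η₁ ≤ η₂ ∧
        D ≤ σ * (δ - ξ₁) + σ * (δ - ξ₂) ∧ D ≤ σ * (δ - ξ₂) + ρ * (η₁ - 1) ∧
        D ≤ ρ * (η₁ - 1) + ρ * (η₂ - 1) := by
      intro η h2 h3 h4
      refine ⟨p, u, ξp, ξu, ηp, η, hpX, hup, hξp.le, hξu.le, hηp.le, h2, hpu.le,
        hξu0.trans h0δ, hηp1, h3, ?_, h1, h4⟩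
      have := mul_lt_mul_of_pos_left hpu hσ
      linarith
    by_cases hBu : Y u ≤ s ^ (-ηB)
    -- `Y u` may be 0, so an explicit exponent is supplied; `ηB` alone contributes `D` to the last
    -- inequality.
    · refine prev (max ηp ηB) ?_ (le_max_left _ _) ?_
      · rcases max_choice ηp ηB with h | h <;> rw [h]
        · exact hup.le.trans hηp.le
        · exact hBu
      · have h2 := mul_nonneg hρ.le (sub_nonneg.mpr hηp1)
        have h3 := mul_le_mul_of_nonneg_left (le_max_right ηp ηB) hρ.le
        linarith
    · obtain ⟨w, ξw, ηu, h2, h3, h4, h5, h6, h7⟩ := next (not_le.mp hBu)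
      -- If the pair `u`, `w` fails here, adding `h1` and `h8` gives `2 * D` as a lower bound for
      -- all four terms; the `σ`-terms total less than `D`, so the `ρ`-terms of the pair `p`, `u`
      -- exceed `D`.
      by_cases hsum : D ≤ σ * (δ - ξu) + σ * (δ - ξw)
      · exact pair_next w ξw ηu h2 h3 h4 h5 h6 h7 hsum
      · have h8 := line ξw ηu (hA0'.trans h5.le) h6 h7
        have h9 : ηp < ηu := by
          rw [h2, hηp, lt_iff] at hup
          linarith
        exact prev ηu h2.le h9.le (by linarith)

/-! ### Weighted norms -/

section WeightedNorm

variable {k : ℕ} {w : Fin k → ℝ}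

theorem weightedNorm_nonneg (w x : Fin k → ℝ) : 0 ≤ weightedNorm w x :=
  Real.iSup_nonneg fun _ => Real.rpow_nonneg (abs_nonneg _) _

theorem weightedNorm_le_iff (hk : 0 < k) (hw : ∀ j, 0 < w j) {x : Fin k → ℝ} {t : ℝ}
    (ht : 0 ≤ t) : weightedNorm w x ≤ t ↔ ∀ j, |x j| ≤ t ^ w j := by
  have : Nonempty (Fin k) := ⟨⟨0, hk⟩⟩
  rw [weightedNorm, ciSup_le_iff (Set.finite_range _).bddAbove]
  refine forall_congr' fun j => ?_
  rw [one_div, Real.rpow_inv_le_iff_of_pos (abs_nonneg _) ht (hw j)]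

theorem abs_le_weightedNorm_rpow (hw : ∀ j, 0 < w j) (x : Fin k → ℝ) (j : Fin k) :
    |x j| ≤ weightedNorm w x ^ w j :=
  (weightedNorm_le_iff j.pos hw (weightedNorm_nonneg w x)).mp le_rfl j

/-- Serves to exhibit a nonzero minor of two consecutive minimal points. -/
theorem exists_abs_lt_of_weightedNorm_lt (hk : 0 < k) (hw : ∀ j, 0 < w j) {x y : Fin k → ℝ}
    (h : weightedNorm w x < weightedNorm w y) : ∃ j, |x j| < |y j| := by
  by_contra! h'
  refine absurd h (not_lt.mpr ?_)
  rw [weightedNorm_le_iff hk hw (weightedNorm_nonneg w x)]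
  exact fun j => (h' j).trans (abs_le_weightedNorm_rpow hw x j)

theorem weightedNorm_pos (hw : ∀ j, 0 < w j) {x : Fin k → ℝ} (hx : x ≠ 0) :
    0 < weightedNorm w x := by
  refine lt_of_le_of_ne (weightedNorm_nonneg w x) fun h0 => hx ?_
  ext j
  have := abs_le_weightedNorm_rpow hw x j
  rw [← h0, Real.zero_rpow (hw j).ne'] at this
  simpa using this

theorem eq_zero_of_weightedNorm_lt_one (hw : ∀ j, 0 < w j) {y : Fin k → ℤ}
    (h : weightedNorm w (fun j => (y j : ℝ)) < 1) : y = 0 := by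
  ext j
  have h1 := (abs_le_weightedNorm_rpow hw (fun j => (y j : ℝ)) j).trans_lt
    (Real.rpow_lt_one (weightedNorm_nonneg _ _) h (hw j))
  exact_mod_cast Int.cast_eq_zero_of_abs_lt_one ⟨y j, rfl⟩ h1

end WeightedNorm

/-! ### The lattice of `Θ`, its dual, and transference at fixed exponents -/

section Lattice

variable {m n : ℕ}

/-- The point `(x, Θ x - y)` of the lattice attached to `Θ`. -/
def latticePoint (Θ : Matrix (Fin n) (Fin m) ℝ) (p : (Fin m → ℤ) × (Fin n → ℤ)) :
    Fin m ⊕ Fin n → ℝ :=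
  Sum.elim (fun j => (p.1 j : ℝ)) (fun i => Θ.mulVec (fun j => (p.1 j : ℝ)) i - (p.2 i : ℝ))

/-- The matrix of the dual lattice: it sends `(y', x')` to `(Θᵀ x' - y', -x')`. -/
def dualMatrix (Θ : Matrix (Fin n) (Fin m) ℝ) : Matrix (Fin m ⊕ Fin n) (Fin m ⊕ Fin n) ℝ :=
  Matrix.fromBlocks (-1) Θ.transpose 0 (-1)

theorem abs_det_dualMatrix (Θ : Matrix (Fin n) (Fin m) ℝ) : |(dualMatrix Θ).det| = 1 := by
  rw [dualMatrix, Matrix.det_fromBlocks_zero₂₁, abs_mul]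
  simp [Matrix.det_neg]

theorem dualMatrix_mulVec_inl (Θ : Matrix (Fin n) (Fin m) ℝ) (z : Fin m ⊕ Fin n → ℝ) (j : Fin m) :
    (dualMatrix Θ).mulVec z (Sum.inl j) =
      Θ.transpose.mulVec (fun i => z (Sum.inr i)) j - z (Sum.inl j) := by
  rw [dualMatrix, Matrix.fromBlocks_mulVec]
  simp [Function.comp_def, Matrix.neg_mulVec]
  ring

theorem dualMatrix_mulVec_inr (Θ : Matrix (Fin n) (Fin m) ℝ) (z : Fin m ⊕ Fin n → ℝ) (i : Fin n) :
    (dualMatrix Θ).mulVec z (Sum.inr i) = -z (Sum.inr i) := by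
  rw [dualMatrix, Matrix.fromBlocks_mulVec]
  simp [Function.comp_def, Matrix.neg_mulVec]

theorem latticePoint_dotProduct_dualMatrix (Θ : Matrix (Fin n) (Fin m) ℝ)
    (p : (Fin m → ℤ) × (Fin n → ℤ)) (z : Fin m ⊕ Fin n → ℤ) :
    ∃ a : ℤ, (a : ℝ) = latticePoint Θ p ⬝ᵥ (dualMatrix Θ).mulVec (fun k => (z k : ℝ)) := by
  refine ⟨∑ i, p.2 i * z (Sum.inr i) - ∑ j, p.1 j * z (Sum.inl j), ?_⟩
  have h : (fun j => (p.1 j : ℝ)) ⬝ᵥ Θ.transpose.mulVec (fun i => (z (Sum.inr i) : ℝ)) =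
      Θ.mulVec (fun j => (p.1 j : ℝ)) ⬝ᵥ (fun i => (z (Sum.inr i) : ℝ)) := by
    rw [Matrix.mulVec_transpose, dotProduct_comm, ← Matrix.dotProduct_mulVec, dotProduct_comm]
  simp only [dotProduct] at h
  simp only [dotProduct, Fintype.sum_sum_type, dualMatrix_mulVec_inl, dualMatrix_mulVec_inr,
    latticePoint, Sum.elim_inl, Sum.elim_inr, mul_sub, sub_mul, mul_neg, Finset.sum_sub_distrib,
    Finset.sum_neg_distrib, h]
  push_cast
  ring

theorem finite_setOf_latticePoint_bounded {σ : Fin m → ℝ} {ρ : Fin n → ℝ} (hσ : ∀ j, 0 < σ j)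
    (hρ : ∀ i, 0 < ρ i) (Θ : Matrix (Fin n) (Fin m) ℝ) (a b : ℝ) :
    {p : (Fin m → ℤ) × (Fin n → ℤ) | weightedNorm σ (fun j => (p.1 j : ℝ)) ≤ a ∧
      weightedNorm ρ (fun i => Θ.mulVec (fun j => (p.1 j : ℝ)) i - (p.2 i : ℝ)) ≤ b}.Finite := by
  have key : ∀ (k : ℕ) (w : Fin k → ℝ), (∀ j, 0 < w j) → ∀ (c : Fin k → ℝ) (t : ℝ),
      {x : Fin k → ℤ | weightedNorm w (fun j => c j - (x j : ℝ)) ≤ t}.Finite := by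
    intro k w hw c t
    refine (Set.finite_Icc (fun j => ⌊c j - t ^ w j⌋) (fun j => ⌈c j + t ^ w j⌉)).subset ?_
    intro x hx
    have h : ∀ j, |c j - (x j : ℝ)| ≤ t ^ w j := fun j =>
      (abs_le_weightedNorm_rpow hw (fun j => c j - (x j : ℝ)) j).trans
        (Real.rpow_le_rpow (weightedNorm_nonneg _ _) hx (hw j).le)
    refine ⟨fun j => ?_, fun j => ?_⟩
    · have h1 := (abs_le.mp (h j)).2
      have h2 := Int.floor_le (c j - t ^ w j)
      exact_mod_cast (by linarith : ((⌊c j - t ^ w j⌋ : ℤ) : ℝ) ≤ x j)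
    · have h1 := (abs_le.mp (h j)).1
      have h2 := Int.le_ceil (c j + t ^ w j)
      exact_mod_cast (by linarith : (x j : ℝ) ≤ (⌈c j + t ^ w j⌉ : ℤ))
  have hx : {x : Fin m → ℤ | weightedNorm σ (fun j => (x j : ℝ)) ≤ a}.Finite := by
    have := key m σ hσ 0 a
    simpa [weightedNorm] using this
  refine ((hx.biUnion fun x _ =>
    (key n ρ hρ (fun i => Θ.mulVec (fun j => (x j : ℝ)) i) b).image fun y => (x, y))).subset ?_
  rintro ⟨x, y⟩ ⟨h1, h2⟩
  simp only [Set.mem_iUnion]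
  exact ⟨x, h1, y, h2, rfl⟩

/-- The exponents of the sides of the dual parallelepiped. -/
def dualSide (σ : Fin m → ℝ) (ρ : Fin n → ℝ) (δ : ℝ) : Fin m ⊕ Fin n → ℝ :=
  Sum.elim (fun j => -(δ * σ j)) ρ

theorem prod_rpow_dualSide {σ : Fin m → ℝ} {ρ : Fin n → ℝ} (hσ_sum : ∑ j, σ j = 1)
    (hρ_sum : ∑ i, ρ i = 1) (δ : ℝ) {s : ℝ} (hs : 0 < s) :
    ∏ k, s ^ dualSide σ ρ δ k = s ^ (-(δ - 1)) := by
  rw [← Real.rpow_sum_of_pos hs]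
  congr 1
  simp only [dualSide, Fintype.sum_sum_type, Sum.elim_inl, Sum.elim_inr, Finset.sum_neg_distrib,
    ← Finset.mul_sum, hσ_sum, hρ_sum]
  ring

/-- The place where only the smallest weights remain: since `δ - ξ` and `η - 1` are nonnegative,
replacing each weight by a lower bound weakens the estimate, and the planar argument can then treat
all coordinates of a block alike. -/
theorem abs_latticePoint_mul_le {σ : Fin m → ℝ} {ρ : Fin n → ℝ} (hσ : ∀ j, 0 < σ j)
    (hρ : ∀ i, 0 < ρ i) {σm ρn : ℝ} (hσm : ∀ j, σm ≤ σ j) (hρn : ∀ i, ρn ≤ ρ i)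
    (Θ : Matrix (Fin n) (Fin m) ℝ) {s δ ξ η : ℝ} (hs : 1 ≤ s) (hξ : ξ ≤ δ) (hη : 1 ≤ η)
    (p : (Fin m → ℤ) × (Fin n → ℤ)) (hX : weightedNorm σ (fun j => (p.1 j : ℝ)) ≤ s ^ ξ)
    (hY : weightedNorm ρ (fun i => Θ.mulVec (fun j => (p.1 j : ℝ)) i - (p.2 i : ℝ)) ≤ s ^ (-η))
    (k : Fin m ⊕ Fin n) :
    |latticePoint Θ p k| * s ^ dualSide σ ρ δ k ≤
      s ^ (-(Sum.elim (fun _ => σm * (δ - ξ)) (fun _ => ρn * (η - 1)) k : ℝ)) := by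
  have hs0 : 0 < s := by linarith
  rcases k with j | i
  · have h1 := (weightedNorm_le_iff j.pos hσ (Real.rpow_nonneg hs0.le _)).mp hX j
    rw [← Real.rpow_mul hs0.le] at h1
    simp only [latticePoint, dualSide, Sum.elim_inl]
    refine (mul_le_mul_of_nonneg_right h1 (Real.rpow_nonneg hs0.le _)).trans ?_
    rw [← Real.rpow_add hs0]
    refine Real.rpow_le_rpow_of_exponent_le hs ?_
    nlinarith [hσm j]
  · have h1 := (weightedNorm_le_iff i.pos hρ (Real.rpow_nonneg hs0.le _)).mp hY i
    rw [← Real.rpow_mul hs0.le] at h1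
    simp only [latticePoint, dualSide, Sum.elim_inr]
    refine (mul_le_mul_of_nonneg_right h1 (Real.rpow_nonneg hs0.le _)).trans ?_
    rw [← Real.rpow_add hs0]
    refine Real.rpow_le_rpow_of_exponent_le hs ?_
    nlinarith [hρn i]

theorem latticePoint_ne_zero (Θ : Matrix (Fin n) (Fin m) ℝ) {p : (Fin m → ℤ) × (Fin n → ℤ)}
    (hp : p ≠ 0) : latticePoint Θ p ≠ 0 := by
  intro h
  apply hp
  have hx : p.1 = 0 := by
    ext j
    have := congrFun h (Sum.inl j)
    simpa [latticePoint] using this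
  have hy : p.2 = 0 := by
    ext i
    have := congrFun h (Sum.inr i)
    simp only [latticePoint, Sum.elim_inr, hx] at this
    have h0 : (fun j => (((0 : Fin m → ℤ) j : ℤ) : ℝ)) = 0 := by
      ext
      simp
    rw [h0, Matrix.mulVec_zero] at this
    simpa using this
  exact Prod.ext hx hy

theorem eventually_exists_dual_point (hm : 0 < m) (hn : 0 < n) (hmn : 3 ≤ m + n)
    {σ : Fin m → ℝ} {ρ : Fin n → ℝ} (hσ : ∀ j, 0 < σ j) (hρ : ∀ i, 0 < ρ i)
    (hσ_sum : ∑ j, σ j = 1) (hρ_sum : ∑ i, ρ i = 1) {σm ρn : ℝ} (hσm0 : 0 < σm) (hρn0 : 0 < ρn)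
    (hσm : ∀ j, σm ≤ σ j) (hρn : ∀ i, ρn ≤ ρ i) (Θ : Matrix (Fin n) (Fin m) ℝ) {γ δ : ℝ}
    (hγ : 0 < γ) (hδ : 1 ≤ δ) (h : ∀ᶠ t : ℝ in atTop, HasNonzeroSolution σ ρ Θ t γ)
    (hA : 1 ≤ γ * (δ - (δ - 1) / σm)) (hB : 1 + (δ - 1) / ρn ≤ γ * δ) :
    ∃ C : ℝ, ∀ᶠ s : ℝ in atTop, ∃ z : Fin m ⊕ Fin n → ℤ, z ≠ 0 ∧
      ∀ k, |(dualMatrix Θ).mulVec (fun j => (z j : ℝ)) k| ≤ C * s ^ dualSide σ ρ δ k := by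
  obtain ⟨t₀, ht₀⟩ := eventually_atTop.mp h
  refine ⟨Fintype.card (Fin m ⊕ Fin n) * (2 + 1), ?_⟩
  have hcard : 3 ≤ Fintype.card (Fin m ⊕ Fin n) := by simpa using hmn
  filter_upwards [eventually_gt_atTop 1,
    (tendsto_rpow_atTop (by positivity : 0 < 1 / γ)).eventually_ge_atTop t₀] with s hs hst
  have hs0 : 0 < s := by linarith
  have hprod := prod_rpow_dualSide hσ_sum hρ_sum δ hs0
  have hμ : ∀ k, 0 < s ^ dualSide σ ρ δ k := fun k => Real.rpow_pos_of_pos hs0 _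
  let P := {p : (Fin m → ℤ) × (Fin n → ℤ) // p ≠ 0}
  let X : P → ℝ := fun p => weightedNorm σ (fun j => (p.1.1 j : ℝ))
  let Y : P → ℝ := fun p =>
    weightedNorm ρ (fun i => Θ.mulVec (fun j => (p.1.1 j : ℝ)) i - (p.1.2 i : ℝ))
  have hX : ∀ p : P, Y p < 1 → 0 < X p := by
    rintro ⟨⟨x, y⟩, hp⟩ hY
    refine weightedNorm_pos hσ fun hx => hp ?_
    simp only at hx
    have hx' : x = 0 := by
      ext j
      simpa using congrFun hx j
    have hy : -y = 0 := by
      refine eq_zero_of_weightedNorm_lt_one hρ ?_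
      simp only [Y, hx, Matrix.mulVec_zero] at hY
      simpa using hY
    rw [hx', neg_eq_zero.mp hy]
    rfl
  rcases exists_good_point_or_pair (X := X) (Y := Y)
    (fun a b => (finite_setOf_latticePoint_bounded hσ hρ Θ a b).preimage
      Subtype.val_injective.injOn)
    (fun p => weightedNorm_nonneg _ _) hX hσm0 hρn0 hγ hδ hs hst
    (fun t ht => by
      obtain ⟨x, y, hxy, h1, h2⟩ := ht₀ t ht
      exact ⟨⟨(x, y), hxy⟩, h1, h2⟩) hA hB with
    ⟨u, hu1, hu2⟩ | ⟨u, v, ξ₁, ξ₂, η₁, η₂, hXuv, hYuv, hu1, hv1, hu2, hv2, hξ, hξδ, hη1, hη, hd1,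
      hd2, hd3⟩
  · refine exists_dual_point_of_single (by omega) _ (abs_det_dualMatrix Θ) (latticePoint Θ u)
      (latticePoint_ne_zero Θ u.2) (latticePoint_dotProduct_dualMatrix Θ u) _ hμ 2 (by norm_num) ?_
    intro k
    have h0 : 0 ≤ (δ - 1) / σm := div_nonneg (by linarith) hσm0.le
    have h0' : 0 ≤ (δ - 1) / ρn := div_nonneg (by linarith) hρn0.le
    have h1 := abs_latticePoint_mul_le hσ hρ hσm hρn Θ hs.le
      (by linarith : δ - (δ - 1) / σm ≤ δ) (by linarith : 1 ≤ 1 + (δ - 1) / ρn) u hu1 hu2 k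
    rw [hprod]
    refine h1.trans ?_
    have h2 : 0 < s ^ (-(δ - 1)) := Real.rpow_pos_of_pos hs0 _
    have h3 : (Sum.elim (fun _ => σm * (δ - (δ - (δ - 1) / σm)))
        (fun _ => ρn * (1 + (δ - 1) / ρn - 1)) k : ℝ) = δ - 1 := by
      rcases k with j | i
      · simp only [Sum.elim_inl]
        field_simp
        ring
      · simp only [Sum.elim_inr]
        field_simp
        ring
    rw [h3]
    linarith
  · refine exists_dual_point_of_pair hcard _ (abs_det_dualMatrix Θ) (latticePoint Θ u)
      (latticePoint Θ v) ?_ (latticePoint_dotProduct_dualMatrix Θ u)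
      (latticePoint_dotProduct_dualMatrix Θ v) _ hμ 2 (by norm_num) ?_
    -- Independence: `X` increases and `Y` decreases from `u` to `v`, so the two products in some
    -- mixed minor have different absolute values.
    · obtain ⟨j, hj⟩ := exists_abs_lt_of_weightedNorm_lt hm hσ hXuv
      obtain ⟨i, hi⟩ := exists_abs_lt_of_weightedNorm_lt hn hρ hYuv
      refine ⟨Sum.inl j, Sum.inr i, fun h0 => ?_⟩
      have h1 := mul_lt_mul'' hj hi (abs_nonneg _) (abs_nonneg _)
      rw [← abs_mul, ← abs_mul] at h1
      simp only [latticePoint, Sum.elim_inl, Sum.elim_inr] at h0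
      rw [sub_eq_zero.mp h0, mul_comm] at h1
      exact lt_irrefl _ h1
    · intro k l
      have hu := abs_latticePoint_mul_le hσ hρ hσm hρn Θ hs.le (hξ.trans hξδ) hη1 u hu1 hu2
      have hv := abs_latticePoint_mul_le hσ hρ hσm hρn Θ hs.le hξδ (hη1.trans hη) v hv1 hv2
      have hsum : ∀ k l : Fin m ⊕ Fin n, δ - 1 ≤
          (Sum.elim (fun _ => σm * (δ - ξ₁)) (fun _ => ρn * (η₁ - 1)) k : ℝ) +
          (Sum.elim (fun _ => σm * (δ - ξ₂)) (fun _ => ρn * (η₂ - 1)) l : ℝ) := by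
        have h1 := mul_le_mul_of_nonneg_left hξ hσm0.le
        have h2 := mul_le_mul_of_nonneg_left hη hρn0.le
        rintro (k | k) (l | l) <;> simp only [Sum.elim_inl, Sum.elim_inr] <;> linarith
      -- A minor is a difference of two such products, hence the constant `K = 2`.
      have hbound : ∀ k l, |latticePoint Θ u k * latticePoint Θ v l| *
          (s ^ dualSide σ ρ δ k * s ^ dualSide σ ρ δ l) ≤ s ^ (-(δ - 1)) := by
        intro k l
        rw [abs_mul, mul_mul_mul_comm]
        refine (mul_le_mul (hu k) (hv l) (mul_nonneg (abs_nonneg _) (hμ l).le)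
          (Real.rpow_nonneg hs0.le _)).trans ?_
        rw [← Real.rpow_add hs0]
        refine Real.rpow_le_rpow_of_exponent_le hs.le ?_
        linarith [hsum k l]
      rw [hprod]
      have h1 := hbound k l
      have h2 := hbound l k
      have h3 := abs_sub (latticePoint Θ u k * latticePoint Θ v l)
        (latticePoint Θ u l * latticePoint Θ v k)
      have h4 := mul_le_mul_of_nonneg_right h3 (mul_pos (hμ k) (hμ l)).le
      rw [mul_comm (s ^ dualSide σ ρ δ l)] at h2
      linarith

theorem eventually_hasNonzeroSolution_transpose (hm : 0 < m) (hn : 0 < n)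
    {σ : Fin m → ℝ} {ρ : Fin n → ℝ} (hσ : ∀ j, 0 < σ j) (hρ : ∀ i, 0 < ρ i)
    (Θ : Matrix (Fin n) (Fin m) ℝ) {C δ δ' : ℝ} (hδ' : 0 < δ') (hδ : δ' < δ)
    (h : ∀ᶠ s : ℝ in atTop, ∃ z : Fin m ⊕ Fin n → ℤ, z ≠ 0 ∧
      ∀ k, |(dualMatrix Θ).mulVec (fun j => (z j : ℝ)) k| ≤ C * s ^ dualSide σ ρ δ k) :
    ∀ᶠ s : ℝ in atTop, HasNonzeroSolution ρ σ Θ.transpose s δ' := by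
  -- The hypothesis is used at `s ^ θ`: `θ < 1` leaves room to absorb `C` in the bounds on `x'`, and
  -- `θ * δ > δ'` in those on `Θᵀ x' - y'`.
  obtain ⟨θ, hθ1, hθ2⟩ : ∃ θ, δ' / δ < θ ∧ θ < 1 :=
    exists_between ((div_lt_one (by linarith)).mpr hδ)
  have hδ0 : 0 < δ := by linarith
  have hθ0 : 0 < θ := lt_trans (by positivity) hθ1
  rw [div_lt_iff₀ hδ0] at hθ1
  have hC : ∀ e : ℝ, 0 < e → ∀ᶠ s : ℝ in atTop, C ≤ s ^ e := fun e he =>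
    (tendsto_rpow_atTop he).eventually_ge_atTop C
  filter_upwards [(tendsto_rpow_atTop hθ0).eventually h, eventually_gt_atTop 1,
    eventually_all.mpr fun j => hC (σ j * (θ * δ - δ')) (mul_pos (hσ j) (by linarith)),
    eventually_all.mpr fun i => hC (ρ i * (1 - θ)) (mul_pos (hρ i) (by linarith))]
    with s ⟨z, hz0, hz⟩ hs h1 h2
  have hs0 : 0 < s := by linarith
  refine ⟨fun i => z (Sum.inr i), fun j => z (Sum.inl j), ?_, ?_, ?_⟩
  · intro h0
    apply hz0
    ext k
    rcases k with j | i
    · exact congrFun (congrArg Prod.snd h0) j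
    · exact congrFun (congrArg Prod.fst h0) i
  · rw [weightedNorm_le_iff hn hρ hs0.le]
    intro i
    have h3 := hz (Sum.inr i)
    rw [dualMatrix_mulVec_inr, abs_neg] at h3
    refine h3.trans ((mul_le_mul_of_nonneg_right (h2 i)
      (Real.rpow_nonneg (Real.rpow_nonneg hs0.le _) _)).trans (le_of_eq ?_))
    simp only [dualSide, Sum.elim_inr]
    rw [← Real.rpow_mul hs0.le, ← Real.rpow_add hs0]
    congr 1
    ring
  · rw [weightedNorm_le_iff hm hσ (Real.rpow_nonneg hs0.le _)]
    intro j
    have h3 := hz (Sum.inl j)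
    rw [dualMatrix_mulVec_inl] at h3
    refine h3.trans ((mul_le_mul_of_nonneg_right (h1 j)
      (Real.rpow_nonneg (Real.rpow_nonneg hs0.le _) _)).trans (le_of_eq ?_))
    simp only [dualSide, Sum.elim_inl]
    rw [← Real.rpow_mul hs0.le, ← Real.rpow_mul hs0.le, ← Real.rpow_add hs0]
    congr 1
    ring

/-- The product of the sides is `t ^ (1 - γ) > 1`, so Minkowski's theorem applies directly. The
resulting bound by 1 on both exponents restricts the main argument to `δ > 1`. -/
theorem hasNonzeroSolution_of_lt_one (hm : 0 < m) (hn : 0 < n)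
    {σ : Fin m → ℝ} {ρ : Fin n → ℝ} (hσ : ∀ j, 0 < σ j) (hρ : ∀ i, 0 < ρ i)
    (hσ_sum : ∑ j, σ j = 1) (hρ_sum : ∑ i, ρ i = 1) (Θ : Matrix (Fin n) (Fin m) ℝ) {t γ : ℝ}
    (ht : 1 < t) (hγ : γ < 1) : HasNonzeroSolution σ ρ Θ t γ := by
  have ht0 : 0 < t := by linarith
  have hdet : |(Matrix.fromBlocks 1 0 Θ (-1) :
      Matrix (Fin m ⊕ Fin n) (Fin m ⊕ Fin n) ℝ).det| = 1 := by
    rw [Matrix.det_fromBlocks_zero₁₂]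
    simp [Matrix.det_neg]
  obtain ⟨z, hz0, hz⟩ := exists_int_ne_zero_forall_abs_mulVec_lt
    (Matrix.fromBlocks 1 0 Θ (-1) : Matrix (Fin m ⊕ Fin n) (Fin m ⊕ Fin n) ℝ)
    (fun h0 => by simp [h0] at hdet)
    (fun k => t ^ (Sum.elim σ (fun i => -γ * ρ i) k : ℝ)) (fun k => Real.rpow_pos_of_pos ht0 _)
    (by
      rw [hdet, ← Real.rpow_sum_of_pos ht0]
      refine Real.one_lt_rpow ht ?_
      simp only [Fintype.sum_sum_type, Sum.elim_inl, Sum.elim_inr, ← Finset.mul_sum, hσ_sum,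
        hρ_sum]
      linarith)
  refine ⟨fun j => z (Sum.inl j), fun i => z (Sum.inr i), ?_, ?_, ?_⟩
  · intro h0
    apply hz0
    ext k
    rcases k with j | i
    · exact congrFun (congrArg Prod.fst h0) j
    · exact congrFun (congrArg Prod.snd h0) i
  · rw [weightedNorm_le_iff hm hσ ht0.le]
    intro j
    have := hz (Sum.inl j)
    simp only [Matrix.fromBlocks_mulVec, Sum.elim_inl, Function.comp_def] at this
    simpa using this.le
  · rw [weightedNorm_le_iff hn hρ (Real.rpow_nonneg ht0.le _)]
    intro i
    have := hz (Sum.inr i)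
    simp only [Matrix.fromBlocks_mulVec, Sum.elim_inr, Function.comp_def, Matrix.neg_mulVec,
      Matrix.one_mulVec, ← sub_eq_add_neg] at this
    rw [← Real.rpow_mul ht0.le]
    exact this.le

theorem one_le_uniformWeightedExponent (hm : 0 < m) (hn : 0 < n)
    {σ : Fin m → ℝ} {ρ : Fin n → ℝ} (hσ : ∀ j, 0 < σ j) (hρ : ∀ i, 0 < ρ i)
    (hσ_sum : ∑ j, σ j = 1) (hρ_sum : ∑ i, ρ i = 1) (Θ : Matrix (Fin n) (Fin m) ℝ) :
    1 ≤ uniformWeightedExponent σ ρ Θ := by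
  by_contra! h
  obtain ⟨r, h1, h2⟩ := EReal.lt_iff_exists_real_btwn.mp h
  refine absurd h1 (not_lt.mpr (le_sSup ⟨r, ?_, rfl⟩))
  filter_upwards [eventually_gt_atTop 1] with t ht
  exact hasNonzeroSolution_of_lt_one hm hn hσ hρ hσ_sum hρ_sum Θ ht (by exact_mod_cast h2)

/-- Transference at a given pair of exponents `γ`, `δ`. -/
theorem le_uniformWeightedExponent_transpose (hm : 0 < m) (hn : 0 < n) (hmn : 3 ≤ m + n)
    {σ : Fin m → ℝ} {ρ : Fin n → ℝ} (hσ : ∀ j, 0 < σ j) (hρ : ∀ i, 0 < ρ i)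
    (hσ_sum : ∑ j, σ j = 1) (hρ_sum : ∑ i, ρ i = 1) {σm ρn : ℝ} (hσm0 : 0 < σm) (hρn0 : 0 < ρn)
    (hσm : ∀ j, σm ≤ σ j) (hρn : ∀ i, ρn ≤ ρ i) (Θ : Matrix (Fin n) (Fin m) ℝ) {γ δ : ℝ}
    (hγ : 0 < γ) (hδ : 1 ≤ δ) (h : ∀ᶠ t : ℝ in atTop, HasNonzeroSolution σ ρ Θ t γ)
    (hA : σm ≤ γ * (1 - δ * (1 - σm))) (hB : δ - 1 + ρn ≤ γ * (δ * ρn)) :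
    (δ : EReal) ≤ uniformWeightedExponent ρ σ Θ.transpose := by
  obtain ⟨C, hC⟩ := eventually_exists_dual_point hm hn hmn hσ hρ hσ_sum hρ_sum hσm0 hρn0 hσm hρn Θ
    hγ hδ h
    (by
      have : γ * (δ - (δ - 1) / σm) = γ * (1 - δ * (1 - σm)) / σm := by
        field_simp
        ring
      rw [this, le_div_iff₀ hσm0]
      linarith)
    (by
      have : 1 + (δ - 1) / ρn = (δ - 1 + ρn) / ρn := by
        field_simp
        ring
      rw [this, div_le_iff₀ hρn0]
      linarith)
  by_contra! hlt
  obtain ⟨r, h1, h2⟩ := EReal.lt_iff_exists_real_btwn.mp hlt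
  have h2' : r < δ := by exact_mod_cast h2
  -- The maximum with `δ / 2` keeps the exponent positive while still below `δ`.
  refine absurd h1 (not_lt.mpr (le_trans (EReal.coe_le_coe_iff.mpr (le_max_left r (δ / 2)))
    (le_sSup ⟨max r (δ / 2), ?_, rfl⟩)))
  exact eventually_hasNonzeroSolution_transpose hm hn hσ hρ Θ
    (lt_max_of_lt_right (by linarith)) (max_lt h2' (by linarith)) hC

end Lattice

/-! ### Comparison of the two bounds on `δ` -/

section Thresholds

variable {σ ρ c W : ℝ}

/-- When `σ < 1` and `ρ * W < 1`, the two conclusions say that `c` lies below `(1 - ρ) / (1 - ρ *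
W)` and below `(1 - σ / W) / (1 - σ)`. Which bound is smaller is decided by `(W - σ) * (1 - ρ * W) -
W * (1 - σ) * (1 - ρ) = (W - 1) * (σ - ρ * W)`, which is nonpositive here. The cases with a
vanishing or negative denominator are treated apart. -/
theorem thresholds_lt_of_ge (hσ : 0 < σ) (hρ : 0 < ρ) (hσ1 : σ ≤ 1) (hρ1 : ρ ≤ 1)
    (hσρ : σ < 1 ∨ ρ < 1) (hc : 1 < c) (hW : 1 ≤ W) (h : σ / ρ ≤ W)
    (hq : 1 - σ ≠ 0 → c < (1 - σ * W⁻¹) / (1 - σ)) :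
    c - 1 + ρ < W * (c * ρ) ∧ σ < W * (1 - c * (1 - σ)) := by
  have hW0 : 0 < W := by linarith
  rw [div_le_iff₀ hρ] at h
  rcases hσ1.lt_or_eq with h1 | rfl
  · have h2 := hq (by linarith)
    rw [lt_div_iff₀ (by linarith)] at h2
    have h3 : W * (c * (1 - σ)) < W - σ := by
      have := mul_lt_mul_of_pos_left h2 hW0
      field_simp at this
      linarith
    refine ⟨?_, by linarith⟩
    by_cases h4 : 1 - W * ρ ≤ 0
    · by_contra! h5
      have h6 : c * (1 - W * ρ) ≤ 0 := mul_nonpos_of_nonneg_of_nonpos (by linarith) h4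
      have h7 : ρ = 1 := by linarith
      subst h7
      have : (c - 1) * (1 - σ) > 0 := mul_pos (by linarith) (by linarith)
      have h8 : W = 1 := by nlinarith
      subst h8
      linarith
    · push Not at h4
      by_contra! h5
      have h6 := mul_lt_mul_of_pos_right h3 h4
      have h7 : W * (1 - σ) * (1 - ρ) ≤ W * (1 - σ) * (c * (1 - W * ρ)) := by
        refine mul_le_mul_of_nonneg_left (by linarith) (mul_nonneg hW0.le (by linarith))
      nlinarith [mul_nonneg (sub_nonneg.mpr hW) (sub_nonneg.mpr h)]
  · have hρ' : ρ < 1 := by simpa using hσρ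
    constructor <;> nlinarith

theorem thresholds_lt_of_le (hσ : 0 < σ) (hρ : 0 < ρ) (hσ1 : σ ≤ 1)
    (hσρ : σ < 1 ∨ ρ < 1) (hc : 1 < c) (hW : 1 ≤ W) (h : W ≤ σ / ρ)
    (hq : 1 - ρ * W ≠ 0 → c < (1 - ρ) / (1 - ρ * W)) :
    c - 1 + ρ < W * (c * ρ) ∧ σ < W * (1 - c * (1 - σ)) := by
  have hW0 : 0 < W := by linarith
  rw [le_div_iff₀ hρ] at h
  have hρ' : ρ < 1 := by
    by_contra! h1
    rcases hσρ with h2 | h2 <;> nlinarith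
  rcases (by nlinarith : 0 ≤ 1 - ρ * W).lt_or_eq with h1 | h1
  · have h2 := hq h1.ne'
    rw [lt_div_iff₀ h1] at h2
    refine ⟨by linarith, ?_⟩
    have hW1 : 1 < W := by
      by_contra! h3
      nlinarith
    -- The difference of the two sides is `(W - 1) * (σ - ρ * W)`.
    have key : W * (1 - σ) * (1 - ρ) ≤ (W - σ) * (1 - ρ * W) := by
      nlinarith [mul_nonneg (sub_nonneg.mpr hW) (sub_nonneg.mpr h)]
    rcases hσ1.lt_or_eq with h3 | rfl
    · have h4 := mul_lt_mul_of_pos_left h2 (mul_pos hW0 (sub_pos.mpr h3))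
      have h5 : (W * (c * (1 - σ))) * (1 - ρ * W) < (W - σ) * (1 - ρ * W) := by linarith
      have := lt_of_mul_lt_mul_right h5 h1.le
      linarith
    · linarith
  · have h3 : σ = 1 := by linarith
    subst h3
    constructor <;> nlinarith

end Thresholds

/-! ### Extended quotients and the conclusion -/

theorem extQuot_coe (a b : ℝ) :
    extQuot (a : EReal) (b : EReal) = if b = 0 then ⊤ else ((a / b : ℝ) : EReal) := by
  simp only [extQuot, EReal.coe_eq_zero, EReal.coe_div]

theorem lt_div_of_lt_extQuot {a b c : ℝ} (h : (c : EReal) < extQuot a b) (hb : b ≠ 0) :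
    c < a / b := by
  rw [extQuot_coe, if_neg hb] at h
  exact_mod_cast h

theorem card_mul_le_one {k : ℕ} {w : Fin k → ℝ} (hsum : ∑ j, w j = 1) {a : ℝ}
    (ha : ∀ j, a ≤ w j) : k * a ≤ 1 := by
  have := Finset.card_nsmul_le_sum Finset.univ w a fun j _ => ha j
  rwa [hsum, Finset.card_univ, Fintype.card_fin, nsmul_eq_mul] at this

theorem theoremt (m n : ℕ) (hm : 0 < m) (hn : 0 < n) (hmn : 3 ≤ m + n)
    (σ : Fin m → ℝ) (ρ : Fin n → ℝ)
    (hσ_pos : ∀ j, 0 < σ j) (hρ_pos : ∀ i, 0 < ρ i)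
    (hσ_anti : Antitone σ) (hρ_anti : Antitone ρ)
    (hσ_sum : ∑ j, σ j = 1) (hρ_sum : ∑ i, ρ i = 1)
    (Θ : Matrix (Fin n) (Fin m) ℝ)
    (σm ρn : ℝ)
    (hσm : σm = σ ⟨m - 1, Nat.sub_one_lt_of_lt hm⟩)
    (hρn : ρn = ρ ⟨n - 1, Nat.sub_one_lt_of_lt hn⟩)
    (ω ω' : EReal)
    (hω : ω = uniformWeightedExponent σ ρ Θ)
    (hω' : ω' = uniformWeightedExponent ρ σ Θ.transpose) :
    (((σm / ρn : ℝ) : EReal) ≤ ω →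
      extQuot (1 - (σm : EReal) * ω⁻¹) (1 - (σm : EReal)) ≤ ω') ∧
    (ω ≤ ((σm / ρn : ℝ) : EReal) →
      extQuot (1 - (ρn : EReal)) (1 - (ρn : EReal) * ω) ≤ ω') := by
  have hσm0 : 0 < σm := hσm ▸ hσ_pos _
  have hρn0 : 0 < ρn := hρn ▸ hρ_pos _
  have hσm_le : ∀ j, σm ≤ σ j := fun j => hσm ▸ hσ_anti (Fin.mk_le_mk.mpr (by omega))
  have hρn_le : ∀ i, ρn ≤ ρ i := fun i => hρn ▸ hρ_anti (Fin.mk_le_mk.mpr (by omega))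
  have hσc := card_mul_le_one hσ_sum hσm_le
  have hρc := card_mul_le_one hρ_sum hρn_le
  have hmR : (1 : ℝ) ≤ m := by exact_mod_cast hm
  have hnR : (1 : ℝ) ≤ n := by exact_mod_cast hn
  have hmnR : (3 : ℝ) ≤ m + n := by exact_mod_cast hmn
  have hσ1 : σm ≤ 1 := by nlinarith
  have hρ1 : ρn ≤ 1 := by nlinarith
  -- Both equal to 1 would force `m = n = 1`.
  have hσρ : σm < 1 ∨ ρn < 1 := by
    by_contra! h
    nlinarith [h.1, h.2]
  have hω1 : 1 ≤ ω :=
    hω ▸ one_le_uniformWeightedExponent hm hn hσ_pos hρ_pos hσ_sum hρ_sum Θ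
  have hω'1 : 1 ≤ ω' :=
    hω' ▸ one_le_uniformWeightedExponent hn hm hρ_pos hσ_pos hρ_sum hσ_sum Θ.transpose
  -- The two fractions are the least `γ` allowed by the two transference conditions at `δ = c`.
  -- Strict inequality with `ω` leaves room for an admissible `γ` above both, even if the supremum
  -- `ω` is not attained.
  have main : ∀ q : EReal, (∀ c : ℝ, 1 < c → (c : EReal) < q → 0 < 1 - c * (1 - σm) ∧
      (((c - 1 + ρn) / (c * ρn) : ℝ) : EReal) < ω ∧
      ((σm / (1 - c * (1 - σm)) : ℝ) : EReal) < ω) → q ≤ ω' := by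
    intro q hq
    by_contra! hlt
    obtain ⟨c, h1, h2⟩ := EReal.lt_iff_exists_real_btwn.mp hlt
    have hc : 1 < c := by exact_mod_cast hω'1.trans_lt h1
    obtain ⟨h3, h4, h5⟩ := hq c hc h2
    have h6 : ((max ((c - 1 + ρn) / (c * ρn)) (σm / (1 - c * (1 - σm))) : ℝ) : EReal) < ω := by
      rcases max_choice ((c - 1 + ρn) / (c * ρn)) (σm / (1 - c * (1 - σm))) with h | h <;> rw [h]
      · exact h4
      · exact h5
    rw [hω, uniformWeightedExponent, lt_sSup_iff] at h6
    obtain ⟨_, ⟨γ, hγS, rfl⟩, hγ⟩ := h6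
    have hγ' := max_lt_iff.mp (EReal.coe_lt_coe_iff.mp hγ)
    have hγ0 : 0 < γ := lt_trans (div_pos hσm0 h3) hγ'.2
    refine absurd h1 (not_lt.mpr ?_)
    rw [hω']
    refine le_uniformWeightedExponent_transpose hm hn hmn hσ_pos hρ_pos hσ_sum hρ_sum hσm0 hρn0
      hσm_le hρn_le Θ hγ0 hc.le hγS ?_ ?_
    · exact ((div_lt_iff₀ h3).mp hγ'.2).le
    · exact ((div_lt_iff₀ (mul_pos (by linarith) hρn0)).mp hγ'.1).le
  have main_coe : ∀ (W : ℝ) (q : EReal), ω = W → (∀ c : ℝ, 1 < c → (c : EReal) < q →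
      c - 1 + ρn < W * (c * ρn) ∧ σm < W * (1 - c * (1 - σm))) → q ≤ ω' := by
    intro W q hW hq
    refine main q fun c hc hcq => ?_
    obtain ⟨h1, h2⟩ := hq c hc hcq
    have hW1 : 1 ≤ W := by
      rw [hW] at hω1
      exact_mod_cast hω1
    have h3 : 0 < 1 - c * (1 - σm) :=
      pos_of_mul_pos_right (hσm0.trans h2) (by linarith)
    rw [hW, EReal.coe_lt_coe_iff, EReal.coe_lt_coe_iff, div_lt_iff₀ h3,
      div_lt_iff₀ (mul_pos (by linarith) hρn0)]
    exact ⟨h3, h1, h2⟩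
  constructor
  · intro h
    induction ω with
    | bot => exact (not_le.mpr (EReal.bot_lt_coe 1) hω1).elim
    | top =>
      refine main _ fun c hc hcq => ⟨?_, EReal.coe_lt_top _, EReal.coe_lt_top _⟩
      have h1 : extQuot (1 - (σm : EReal) * (⊤ : EReal)⁻¹) (1 - (σm : EReal)) =
          extQuot ((1 : ℝ) : EReal) ((1 - σm : ℝ) : EReal) := by
        rw [EReal.inv_top, mul_zero, sub_zero]
        rfl
      rw [h1] at hcq
      rcases hσ1.lt_or_eq with h2 | rfl
      · have h3 := lt_div_of_lt_extQuot hcq (by linarith)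
        rw [lt_div_iff₀ (by linarith)] at h3
        linarith
      · norm_num
    | coe W =>
      refine main_coe W _ rfl fun c hc hcq => ?_
      refine thresholds_lt_of_ge hσm0 hρn0 hσ1 hρ1 hσρ hc (by exact_mod_cast hω1)
        (by exact_mod_cast h) fun hb => ?_
      refine lt_div_of_lt_extQuot ?_ hb
      rw [← EReal.coe_inv] at hcq
      exact_mod_cast hcq
  · intro h
    induction ω with
    | bot => exact (not_le.mpr (EReal.bot_lt_coe 1) hω1).elim
    | top => simp at h
    | coe W =>
      refine main_coe W _ rfl fun c hc hcq => ?_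
      refine thresholds_lt_of_le hσm0 hρn0 hσ1 hσρ hc (by exact_mod_cast hω1)
        (by exact_mod_cast h) fun hb => ?_
      refine lt_div_of_lt_extQuot ?_ hb
      exact_mod_cast hcq
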